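/- Fix $S\ge 2$ signal modes $a_1,\dots,a_S$ and $S$ probe modes $b_1,\dots,b_S$, and a passive beam splitter that acts identically on every pair $(a_s,b_s)$ (trivial partition), with Heisenberg action $a_s' = \eta a_s+\zeta b_s$, $b_s'=\zeta a_s-\eta b_s$, where $\eta,\zeta$ are nonzero real numbers with $\eta^2+\zeta^2=1$. The probe is in the coherent state with amplitude $\gamma$ in $b_1$ and vacuum in $b_2,\dots,b_S$. One photon counter registers the total photon number $k$ of the modes $a_1',\dots,a_S'$; for an input state $\rho$ let $p_k(\gamma;\rho)$ be the probability of the outcome $k$. A twirled state is a density operator of the form $\tilde\rho_2=\sum_{n\ge 0}\chi_n\otimes|n\rangle\langle n|$, where the $\chi_n$ are operators on the mode $a_1$, $|n\rangle$ are the Fock states of $a_2$, and $a_3,\dots,a_S$ are in the vacuum. It has at most $N$ photons if it is supported on the span of the Fock states with at most $N$ photons in total, and its maximum photon number is the least such $N$. Let $R>0$ and let $N\ge 0$ be an integer. Say that the twirled states of a class are determined by the counter at probe magnitude $R$ if any two states $\rho,\sigma$ of the class with $p_k(Re^{i\theta};\rho)=p_k(Re^{i\theta};\sigma)$ for all $k\ge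 0$ and all phases $\theta\in\mathbb R$ are equal. **Theorem.** The twirled states with at most $N$ photons are determined by the counter at probe magnitude $R$ if and only if $N\le 1$. Likewise, the twirled states with maximum photon number exactly $N$ are determined by the counter at probe magnitude $R$ if and only if $N\le 1$. -/

import Mathlib

open scoped BigOperators Nat ComplexConjugate ComplexOrder

noncomputable section

namespace WFH

/-- Occupation-number labels of the Fock basis of `S` optical modes. -/
abbrev Fock (S : ℕ) : Type := Fin S → ℕ

/-- The total number of photons in a Fock basis vector. -/
def photons {S : ℕ} (m : Fock S) : ℕ := ∑ s, m s

/-- Matrices, with respect to the Fock basis, of density operators on the `S`-mode Fock space: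
positive semidefinite with trace one. -/
def IsDensityMatrix {S : ℕ} (ρ : Matrix (Fock S) (Fock S) ℂ) : Prop :=
  ρ.PosSemidef ∧ HasSum (fun m => ρ m m) 1

/-- The two-mode twirled form `∑ₙ χₙ ⊗ |n⟩⟨n|` : the matrices `χₙ` act on the first mode (the one
that matches the probe), the Fock projectors act on the second mode, and every further mode is in
the vacuum. -/
def IsTwirled {r : ℕ} (ρ : Matrix (Fock (r + 2)) (Fock (r + 2)) ℂ) : Prop :=
  ∃ χ : ℕ → Matrix ℕ ℕ ℂ, ∀ m m' : Fock (r + 2),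
    ((m 1 = m' 1 ∧ ∀ s : Fin (r + 2), 2 ≤ s.val → m s = 0 ∧ m' s = 0) →
      ρ m m' = χ (m 1) (m 0) (m' 0)) ∧
    (¬ (m 1 = m' 1 ∧ ∀ s : Fin (r + 2), 2 ≤ s.val → m s = 0 ∧ m' s = 0) → ρ m m' = 0)

/-- The state has at most `N` photons: it is supported on the span of the Fock basis vectors with
at most `N` photons. -/
def AtMostPhotons {S : ℕ} (ρ : Matrix (Fock S) (Fock S) ℂ) (N : ℕ) : Prop :=
  ∀ m m' : Fock S, ρ m m' ≠ 0 → photons m ≤ N ∧ photons m' ≤ N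

/-- The maximum photon number of the state is `N`. -/
def HasMaxPhotonNumber {S : ℕ} (ρ : Matrix (Fock S) (Fock S) ℂ) (N : ℕ) : Prop :=
  IsLeast {n : ℕ | AtMostPhotons ρ n} N

/-- Fock coefficients `⟨q | g⟩` of the multi-mode coherent state with amplitude vector `g`. -/
def coherent {S : ℕ} (g : Fin S → ℂ) (q : Fock S) : ℂ :=
  ∏ s, (Real.exp (-‖g s‖ ^ 2 / 2) : ℂ) * g s ^ q s / (Real.sqrt (q s)! : ℂ)

/-- Fock matrix elements `⟨k, l| V |p, q⟩` of the unitary `V` of a beam splitter that acts on one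
pair of modes with creation operators `a†`, `b†` (here the variables `X 0`, `X 1`) by
`V a† V⁻¹ = η a† + ζ b†` and `V b† V⁻¹ = ζ a† - η b†`, and fixes the vacuum. Thus
`V |p, q⟩ = (p! q!)^(-1/2) (η a† + ζ b†)^p (ζ a† - η b†)^q |0, 0⟩`, and
`(a†)^k (b†)^l |0, 0⟩ = (k! l!)^(1/2) |k, l⟩`. -/
def pairAmplitude (η ζ : ℝ) (k l p q : ℕ) : ℝ :=
  Real.sqrt ((k ! * l ! : ℝ) / (p ! * q ! : ℝ)) *
    MvPolynomial.coeff (Finsupp.single 0 k + Finsupp.single 1 l)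
      ((MvPolynomial.C η * MvPolynomial.X 0 + MvPolynomial.C ζ * MvPolynomial.X 1) ^ p *
        (MvPolynomial.C ζ * MvPolynomial.X 0 - MvPolynomial.C η * MvPolynomial.X 1) ^ q :
          MvPolynomial (Fin 2) ℝ)

/-- The Fock matrix of the beam splitter `I_S ⊗ [[η, ζ], [ζ, -η]]` that is characterized by the
trivial partition: it acts identically on each of the `S` pairs consisting of a signal mode and
the probe mode with the same label. Signal occupations (output: those of the path that leads to
the counter) come first, probe occupations second. -/
def beamSplitter {S : ℕ} (η ζ : ℝ) (x y : Fock S × Fock S) : ℂ :=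
  ∏ s, (pairAmplitude η ζ (x.1 s) (x.2 s) (y.1 s) (y.2 s) : ℂ)

/-- The matrix of the joint input `ρ ⊗ |g⟩⟨g|`, with the probe in the coherent state `g`. -/
def jointInput {S : ℕ} (ρ : Matrix (Fock S) (Fock S) ℂ) (g : Fin S → ℂ)
    (y y' : Fock S × Fock S) : ℂ :=
  ρ y.1 y'.1 * (coherent g y.2 * conj (coherent g y'.2))

/-- Diagonal Fock elements of the output state `U (ρ ⊗ |g⟩⟨g|) U†`. By conservation of the number
of photons in each pair of modes, the sums have only finitely many nonzero terms. -/
def outputDiag {S : ℕ} (η ζ : ℝ) (ρ : Matrix (Fock S) (Fock S) ℂ) (g : Fin S → ℂ)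
    (x : Fock S × Fock S) : ℝ :=
  (∑' y : Fock S × Fock S, ∑' y' : Fock S × Fock S,
    beamSplitter η ζ x y * jointInput ρ g y y' * conj (beamSplitter η ζ x y')).re

/-- Born's rule for the photon counter: the probability that the counter, which registers the total
number of photons in all `S` modes of the first output path, shows `k` photons. -/
def counterProb {S : ℕ} (η ζ : ℝ) (ρ : Matrix (Fock S) (Fock S) ℂ) (g : Fin S → ℂ) (k : ℕ) : ℝ :=
  ∑' x : {x : Fock S × Fock S // photons x.1 = k}, outputDiag η ζ ρ g x

/-- The probe amplitude vector `γ e₁` with `γ = R exp(iθ)`. -/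
def probe (r : ℕ) (R θ : ℝ) : Fin (r + 2) → ℂ :=
  Pi.single 0 ((R : ℂ) * Complex.exp (θ * Complex.I))

/-- Every twirled state satisfying `P` is determined, among the twirled states satisfying `P`, by
the outcome distributions of the counter for the probe amplitudes of magnitude `R` and any
phase. -/
def DeterminedByCounter (r : ℕ) (η ζ R : ℝ)
    (P : Matrix (Fock (r + 2)) (Fock (r + 2)) ℂ → Prop) : Prop :=
  ∀ ρ σ : Matrix (Fock (r + 2)) (Fock (r + 2)) ℂ,
    IsDensityMatrix ρ → IsTwirled ρ → P ρ →
    IsDensityMatrix σ → IsTwirled σ → P σ →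
    (∀ (θ : ℝ) (k : ℕ),
      counterProb η ζ ρ (probe r R θ) k = counterProb η ζ σ (probe r R θ) k) →
    ρ = σ

end WFH

end

/-!
For a probe in the coherent state `γ`, the counter statistics of a twirled state are linear in its
matrix elements `⟨a, b| ρ |a', b⟩`, with the coefficients `counterKernel`. Photon conservation in
each pair of modes leaves a single probe component per amplitude (`outputDiag_eq_sum`), so
that all sums reduce to the first two pairs (`counterProb_eq`). The second pair thins the photons of
the second mode binomially. In the first pair the vacuum gives a Poisson law with mean
`l = ζ² |γ|²`, and one signal photon multiplies the amplitude by a factor affine in the output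
numbers (`mixedAmplitude_one`). Hence, up to the Poisson weight of the count `k`:

* `|0, 0⟩` contributes `1`, and `|1, 0⟩` contributes `η² (k - l)² / l + ζ²`;
* `|0, 1⟩` contributes `ζ² + η² k / l`, and `|0, 2⟩` contributes a polynomial of degree two in `k`;
* the coherence between `|1, 0⟩` and `|0, 0⟩` contributes `(η / ζ) (k - l) / γ`.

With at most one photon, the coherence is separated from the populations by changing the phase of
`γ`, and the counts `0` and `1` together with the normalization fix the three populations
(`determinedByCounter_atMostPhotons_one`).

With two photons available, four populations contribute polynomials of degree at most two in `k`,
which are linearly dependent (`counterKernel_relation`). The two sides of the relation have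
nonnegative coefficients with equal sums. Mixing each side with `|0, N⟩` gives two different states
with the same statistics (`exists_indistinguishable`).
-/

namespace WFH

/-! ### Amplitudes of a single pair of modes -/

open MvPolynomial in
lemma coeff_linear_form_pow (a b : ℝ) {n i j : ℕ} (h : i + j = n) :
    coeff (Finsupp.single 0 i + Finsupp.single 1 j)
      ((C a * X 0 + C b * X 1 : MvPolynomial (Fin 2) ℝ) ^ n) = n.choose i * (a ^ i * b ^ j) := by
  have key : ∀ m ∈ Finset.range (n + 1),
      coeff (Finsupp.single 0 i + Finsupp.single 1 j)
        ((C a * X 0 : MvPolynomial (Fin 2) ℝ) ^ m * (C b * X 1) ^ (n - m) * ((n.choose m : ℕ) : MvPolynomial (Fin 2) ℝ)) =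
      if m = i then (n.choose i * (a ^ i * b ^ j) : ℝ) else 0 := by
    intro m hm
    have hmono : (C a * X 0 : MvPolynomial (Fin 2) ℝ) ^ m * (C b * X 1) ^ (n - m)
          * ((n.choose m : ℕ) : MvPolynomial (Fin 2) ℝ) =
        monomial (Finsupp.single 0 m + Finsupp.single 1 (n - m))
          (n.choose m * (a ^ m * b ^ (n - m))) := by
      rw [← map_natCast (C (σ := Fin 2) (R := ℝ)), mul_pow, mul_pow, ← C_pow, ← C_pow,
        X_pow_eq_monomial, X_pow_eq_monomial, C_mul_monomial, C_mul_monomial, monomial_mul,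
        mul_comm, C_mul_monomial]
      simp
    rw [hmono, coeff_monomial]
    by_cases hmi : m = i
    · subst hmi
      have : n - m = j := by omega
      simp [this]
    · rw [if_neg hmi, if_neg]
      intro h'
      have := DFunLike.congr_fun h' 0
      simp at this
      exact hmi this
  rw [add_pow, coeff_sum, Finset.sum_congr rfl key, Finset.sum_ite_eq' (Finset.range (n + 1)) i,
    if_pos (Finset.mem_range.2 (by omega))]

open MvPolynomial in
/-- The beam splitter conserves the number of photons in each pair of modes. -/
lemma pairAmplitude_eq_zero (η ζ : ℝ) {k l p q : ℕ} (h : k + l ≠ p + q) :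
    pairAmplitude η ζ k l p q = 0 := by
  have h1 : ∀ a b : ℝ, (C a * X 0 + C b * X 1 : MvPolynomial (Fin 2) ℝ).IsHomogeneous 1 := by
    intro a b
    have h : ∀ (c : ℝ) (s : Fin 2), (C c * X s : MvPolynomial (Fin 2) ℝ).IsHomogeneous 1 := by
      intro c s
      simpa using (isHomogeneous_C (Fin 2) c).mul (isHomogeneous_X ℝ s)
    exact (h a 0).add (h b 1)
  have h2 : (C ζ * X 0 - C η * X 1 : MvPolynomial (Fin 2) ℝ) = C ζ * X 0 + C (-η) * X 1 := by
    simp [sub_eq_add_neg]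
  have h3 := ((h1 η ζ).pow p).mul ((h1 ζ (-η)).pow q)
  rw [pairAmplitude, h2, h3.coeff_eq_zero, mul_zero]
  simpa [Finsupp.degree_eq_sum] using h

lemma pairAmplitude_vacuum_left (η ζ : ℝ) (i j : ℕ) :
    pairAmplitude η ζ i j 0 (i + j) =
      Real.sqrt (i ! * j ! / (i + j)!) * ((i + j).choose i * (ζ ^ i * (-η) ^ j)) := by
  have h2 : (MvPolynomial.C ζ * MvPolynomial.X 0 - MvPolynomial.C η * MvPolynomial.X 1 :
      MvPolynomial (Fin 2) ℝ) =
      MvPolynomial.C ζ * MvPolynomial.X 0 + MvPolynomial.C (-η) * MvPolynomial.X 1 := by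
    simp [sub_eq_add_neg]
  rw [pairAmplitude, h2, pow_zero, one_mul, coeff_linear_form_pow _ _ rfl]
  simp

lemma pairAmplitude_vacuum_right (η ζ : ℝ) (i j : ℕ) :
    pairAmplitude η ζ i j (i + j) 0 =
      Real.sqrt (i ! * j ! / (i + j)!) * ((i + j).choose i * (η ^ i * ζ ^ j)) := by
  rw [pairAmplitude, pow_zero, mul_one, coeff_linear_form_pow _ _ rfl]
  simp

lemma choose_mul_factorial_mul_factorial_of_add_eq {i j n : ℕ} (h : i + j = n) :
    (n.choose i * i ! * j ! : ℝ) = n ! := by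
  have := Nat.choose_mul_factorial_mul_factorial (show i ≤ n by omega)
  rw [show n - i = j by omega] at this
  exact_mod_cast this

lemma factorial_ratio_mul_choose_sq (i j : ℕ) :
    (i ! * j ! / (i + j)! : ℝ) * ((i + j).choose i : ℝ) ^ 2 = (i + j).choose i := by
  have h : ((i + j).choose i * i ! * j ! : ℝ) = (i + j)! := 
    choose_mul_factorial_mul_factorial_of_add_eq rfl
  have hpos : ((i + j)! : ℝ) ≠ 0 := by positivity
  field_simp
  rw [← h]; ring

open MvPolynomial in
/-- One photon against `q` photons: the coefficient of `(η X₀ + ζ X₁) (ζ X₀ - η X₁) ^ q`, cleared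
of the denominators `ζ`, `η` and of the factorials. -/
lemma pairAmplitude_one_left (η ζ : ℝ) {i j q : ℕ} (h : i + j = q + 1) :
    η * ζ * pairAmplitude η ζ i j 1 q =
      Real.sqrt (i ! * j ! / q !) * (q ! / (i ! * j !) * (ζ ^ i * (-η) ^ j)) *
        (η ^ 2 * i - ζ ^ 2 * j) := by
  have h2 : (C ζ * X 0 - C η * X 1 : MvPolynomial (Fin 2) ℝ) = C ζ * X 0 + C (-η) * X 1 := by
    simp [sub_eq_add_neg]
  -- the monomial `X₀` shifts `i`, and contributes only for `i ≠ 0`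
  have e0 : ζ * coeff (Finsupp.single 0 i + Finsupp.single 1 j)
      (X 0 * (C ζ * X 0 + C (-η) * X 1) ^ q : MvPolynomial (Fin 2) ℝ) =
      i * (q ! / (i ! * j !) * (ζ ^ i * (-η) ^ j)) := by
    rw [coeff_X_mul']
    rcases i with _ | i
    · simp
    · have hs : (Finsupp.single 0 (i + 1) + Finsupp.single 1 j - Finsupp.single 0 1 : Fin 2 →₀ ℕ) =
          Finsupp.single 0 i + Finsupp.single 1 j := by
        ext s; fin_cases s <;> simp
      have hq : i + j = q := by omega
      have hc : (q.choose i * i ! * j ! : ℝ) = q ! := 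
        choose_mul_factorial_mul_factorial_of_add_eq hq
      rw [if_pos (by simp), hs, coeff_linear_form_pow _ _ hq, ← hc, Nat.factorial_succ]
      push_cast
      field_simp
      ring
  have e1 : (-η) * coeff (Finsupp.single 0 i + Finsupp.single 1 j)
      (X 1 * (C ζ * X 0 + C (-η) * X 1) ^ q : MvPolynomial (Fin 2) ℝ) =
      j * (q ! / (i ! * j !) * (ζ ^ i * (-η) ^ j)) := by
    rw [coeff_X_mul']
    rcases j with _ | j
    · simp
    · have hs : (Finsupp.single 0 i + Finsupp.single 1 (j + 1) - Finsupp.single 1 1 : Fin 2 →₀ ℕ) =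
          Finsupp.single 0 i + Finsupp.single 1 j := by
        ext s; fin_cases s <;> simp
      have hq : i + j = q := by omega
      have hc : (q.choose i * i ! * j ! : ℝ) = q ! := 
        choose_mul_factorial_mul_factorial_of_add_eq hq
      rw [if_pos (by simp), hs, coeff_linear_form_pow _ _ hq, ← hc, Nat.factorial_succ]
      push_cast
      field_simp
      ring
  rw [pairAmplitude, h2, pow_one, add_mul, coeff_add, mul_assoc (C η), mul_assoc (C ζ), coeff_C_mul,
    coeff_C_mul]
  simp only [Nat.factorial_one, Nat.cast_one, one_mul]
  linear_combination (Real.sqrt (i ! * j ! / q !) * η ^ 2) * e0 -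
    (Real.sqrt (i ! * j ! / q !) * ζ ^ 2) * e1

lemma pairAmplitude_vacuum (η ζ : ℝ) (i j : ℕ) :
    pairAmplitude η ζ i j 0 0 = if i = 0 ∧ j = 0 then 1 else 0 := by
  split_ifs with h
  · obtain ⟨rfl, rfl⟩ := h
    simpa using pairAmplitude_vacuum_right η ζ 0 0
  · exact pairAmplitude_eq_zero η ζ (by omega)

/-- A Fock state against the vacuum is thinned: each photon goes to the first output with
probability `η ^ 2`. -/
lemma hasSum_pairAmplitude_sq (η ζ : ℝ) (n i : ℕ) :
    HasSum (fun j => ((pairAmplitude η ζ i j n 0 : ℂ) * conj (pairAmplitude η ζ i j n 0 : ℂ)))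
      ((n.choose i * (η ^ 2) ^ i * (ζ ^ 2) ^ (n - i) : ℝ) : ℂ) := by
  have h0 : ∀ j, j ≠ n - i →
      (pairAmplitude η ζ i j n 0 : ℂ) * conj (pairAmplitude η ζ i j n 0 : ℂ) = 0 := by
    intro j hj
    rw [pairAmplitude_eq_zero η ζ (by omega)]; simp
  have hv : (pairAmplitude η ζ i (n - i) n 0 : ℂ) * conj (pairAmplitude η ζ i (n - i) n 0 : ℂ) =
      ((n.choose i * (η ^ 2) ^ i * (ζ ^ 2) ^ (n - i) : ℝ) : ℂ) := by
    rw [Complex.conj_ofReal, ← Complex.ofReal_mul]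
    congr 1
    rcases le_or_gt i n with hin | hin
    · obtain ⟨j, rfl⟩ := Nat.exists_eq_add_of_le hin
      rw [Nat.add_sub_cancel_left, pairAmplitude_vacuum_right]
      have hs : Real.sqrt (i ! * j ! / (i + j)!) ^ 2 = (i ! * j ! / (i + j)! : ℝ) :=
        Real.sq_sqrt (by positivity)
      have := factorial_ratio_mul_choose_sq i j
      rw [← hs] at this
      linear_combination (η ^ i * ζ ^ j) ^ 2 * this
    · rw [pairAmplitude_eq_zero η ζ (by omega), Nat.choose_eq_zero_of_lt hin]; simp
  rw [← hv]
  exact hasSum_single _ h0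

/-! ### The coherent probe mode -/

/-- The amplitude `⟨i, j| V |a, γ⟩` of the output numbers `i`, `j` when a Fock state with `a` photons
meets the coherent state `γ`. By photon conservation only the term `i + j - a` of the coherent
state contributes; for `i + j < a` the truncated subtraction is harmless because
`pairAmplitude` vanishes. -/
noncomputable def mixedAmplitude (η ζ : ℝ) (γ : ℂ) (a i j : ℕ) : ℂ :=
  pairAmplitude η ζ i j a (i + j - a) *
    ((Real.exp (-‖γ‖ ^ 2 / 2) : ℂ) * γ ^ (i + j - a) / (Real.sqrt (i + j - a)! : ℂ))

/-- The Poisson probabilities with mean `l`. -/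
noncomputable def poissonWeight (l : ℝ) (n : ℕ) : ℝ := Real.exp (-l) * l ^ n / n !

lemma sqrt_factorial_ratio_mul (i j q : ℕ) :
    Real.sqrt (i ! * j ! / q !) * (q ! / (i ! * j !)) / Real.sqrt (q !) =
      (Real.sqrt (i ! * j !))⁻¹ := by
  have hq : Real.sqrt (q ! : ℝ) ^ 2 = q ! := Real.sq_sqrt (by positivity)
  have hij : Real.sqrt (i ! * j ! : ℝ) ^ 2 = i ! * j ! := Real.sq_sqrt (by positivity)
  have hq0 : Real.sqrt (q ! : ℝ) ≠ 0 := by positivity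
  have hij0 : Real.sqrt (i ! * j ! : ℝ) ≠ 0 := by positivity
  rw [Real.sqrt_div (by positivity), ← hq, ← hij]
  simp only [Real.sqrt_sq (Real.sqrt_nonneg _)]
  field_simp

/-- A coherent state and the vacuum leave the beam splitter as two coherent states, with amplitudes
`ζ γ` and `-η γ`. -/
lemma mixedAmplitude_zero (η ζ : ℝ) (γ : ℂ) (i j : ℕ) :
    mixedAmplitude η ζ γ 0 i j =
      (Real.exp (-‖γ‖ ^ 2 / 2) : ℂ) * γ ^ (i + j) *
        (((Real.sqrt (i ! * j !))⁻¹ * (ζ ^ i * (-η) ^ j) : ℝ) : ℂ) := by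
  have hc : ((i + j).choose i : ℝ) = (i + j)! / (i ! * j !) := by
    have : ((i + j).choose i * i ! * j ! : ℝ) = (i + j)! := 
      choose_mul_factorial_mul_factorial_of_add_eq rfl
    rw [← this]; field_simp
  rw [mixedAmplitude, Nat.sub_zero, pairAmplitude_vacuum_left, ← sqrt_factorial_ratio_mul i j (i + j),
    hc]
  push_cast
  ring

/-- Adding a signal photon multiplies the amplitude by a factor affine in the output numbers. -/
lemma mixedAmplitude_one {η ζ : ℝ} {γ : ℂ} (hη : η ≠ 0) (hζ : ζ ≠ 0) (hγ : γ ≠ 0) (i j : ℕ) :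
    mixedAmplitude η ζ γ 1 i j =
      mixedAmplitude η ζ γ 0 i j * (((η ^ 2 * i - ζ ^ 2 * j : ℝ) : ℂ) / (η * ζ * γ)) := by
  have hη' : (η : ℂ) ≠ 0 := by exact_mod_cast hη
  have hζ' : (ζ : ℂ) ≠ 0 := by exact_mod_cast hζ
  rw [mixedAmplitude_zero]
  rcases Nat.eq_zero_or_pos (i + j) with h | h
  · obtain ⟨rfl, rfl⟩ : i = 0 ∧ j = 0 := by omega
    simp [mixedAmplitude, pairAmplitude_eq_zero η ζ (show 0 + 0 ≠ 1 + 0 by omega)]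
  · obtain ⟨q, hq⟩ : ∃ q, i + j = q + 1 := ⟨i + j - 1, by omega⟩
    have h1 := congrArg (fun t : ℝ => (t : ℂ)) (pairAmplitude_one_left η ζ hq)
    rw [mixedAmplitude, ← sqrt_factorial_ratio_mul i j q, hq, Nat.add_sub_cancel, pow_succ γ]
    simp only [Complex.ofReal_mul, Complex.ofReal_sub, Complex.ofReal_div, Complex.ofReal_pow,
      Complex.ofReal_neg, Complex.ofReal_natCast] at h1 ⊢
    rw [eq_comm, ← mul_div_assoc, div_eq_iff (by simp [hη', hζ', hγ])]
    have hs : (Real.sqrt (q ! : ℝ) : ℂ) ≠ 0 := by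
      exact_mod_cast (show Real.sqrt (q ! : ℝ) ≠ 0 by positivity)
    linear_combination (-(Real.exp (-‖γ‖ ^ 2 / 2) : ℂ) * γ ^ q * γ / (Real.sqrt (q ! : ℝ) : ℂ)) * h1

lemma mixedAmplitude_zero_mul_conj (η ζ : ℝ) (γ : ℂ) (hunit : η ^ 2 + ζ ^ 2 = 1) (i j : ℕ) :
    mixedAmplitude η ζ γ 0 i j * conj (mixedAmplitude η ζ γ 0 i j) =
      ((poissonWeight (ζ ^ 2 * ‖γ‖ ^ 2) i * poissonWeight (η ^ 2 * ‖γ‖ ^ 2) j : ℝ) : ℂ) := by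
  rw [Complex.mul_conj, mixedAmplitude_zero]
  congr 1
  have hs : Real.sqrt (i ! * j ! : ℝ) ^ 2 = i ! * j ! := Real.sq_sqrt (by positivity)
  have he : Real.exp (-‖γ‖ ^ 2 / 2) ^ 2 =
      Real.exp (-(ζ ^ 2 * ‖γ‖ ^ 2)) * Real.exp (-(η ^ 2 * ‖γ‖ ^ 2)) := by
    rw [← Real.exp_add, ← Real.exp_nat_mul]
    congr 1
    push_cast
    linear_combination (‖γ‖ ^ 2) * hunit
  rw [Complex.normSq_eq_norm_sq, norm_mul, norm_mul, norm_pow, Complex.norm_real, Complex.norm_real,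
    mul_pow, mul_pow, Real.norm_eq_abs, Real.norm_eq_abs, sq_abs, sq_abs, he, poissonWeight,
    poissonWeight, mul_pow, inv_pow, hs]
  have : ((-η) ^ j) ^ 2 = (η ^ 2) ^ j := by rw [← pow_mul, mul_comm, pow_mul, neg_sq]
  rw [mul_pow _ _ 2, this]
  field_simp
  ring

/-! ### Poisson moments and the statistics of the first pair -/

lemma hasSum_poissonWeight (l : ℝ) : HasSum (poissonWeight l) 1 := by
  have h := (NormedSpace.expSeries_div_hasSum_exp (𝔸 := ℝ) l).mul_left (Real.exp (-l))
  rw [← Real.exp_eq_exp_ℝ, ← Real.exp_add, neg_add_cancel, Real.exp_zero] at h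
  have hf : poissonWeight l = fun n => Real.exp (-l) * (l ^ n / n !) :=
    funext fun n => mul_div_assoc _ _ _
  rwa [hf]

lemma succ_mul_poissonWeight_succ (l : ℝ) (n : ℕ) :
    ((n + 1 : ℕ) : ℝ) * poissonWeight l (n + 1) = l * poissonWeight l n := by
  rw [poissonWeight, poissonWeight, Nat.factorial_succ]
  push_cast
  field_simp
  ring

lemma hasSum_mul_poissonWeight (l : ℝ) : HasSum (fun n : ℕ => n * poissonWeight l n) l := by
  refine (hasSum_nat_add_iff' 1).1 ?_
  simp only [succ_mul_poissonWeight_succ]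
  simpa using (hasSum_poissonWeight l).mul_left l

lemma hasSum_sq_mul_poissonWeight (l : ℝ) :
    HasSum (fun n : ℕ => (n : ℝ) ^ 2 * poissonWeight l n) (l ^ 2 + l) := by
  refine (hasSum_nat_add_iff' 1).1 ?_
  have h : ∀ n : ℕ, ((n + 1 : ℕ) : ℝ) ^ 2 * poissonWeight l (n + 1) =
      l * (n * poissonWeight l n) + l * poissonWeight l n := by
    intro n
    rw [sq, mul_assoc, succ_mul_poissonWeight_succ]
    push_cast; ring
  simp only [h]
  have hv : l ^ 2 + l - ∑ n ∈ Finset.range 1, (n : ℝ) ^ 2 * poissonWeight l n = l * l + l * 1 := by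
    simp [sq]
  rw [hv]
  exact ((hasSum_mul_poissonWeight l).mul_left l).add ((hasSum_poissonWeight l).mul_left l)

section
variable {η ζ : ℝ} {γ : ℂ}

lemma hasSum_mixedAmplitude_zero_zero (hunit : η ^ 2 + ζ ^ 2 = 1) (i : ℕ) :
    HasSum (fun j => mixedAmplitude η ζ γ 0 i j * conj (mixedAmplitude η ζ γ 0 i j))
      ((poissonWeight (ζ ^ 2 * ‖γ‖ ^ 2) i : ℝ) : ℂ) := by
  simp only [mixedAmplitude_zero_mul_conj η ζ γ hunit]
  simpa using Complex.hasSum_ofReal.2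
    ((hasSum_poissonWeight (η ^ 2 * ‖γ‖ ^ 2)).mul_left (poissonWeight (ζ ^ 2 * ‖γ‖ ^ 2) i))

lemma hasSum_mixedAmplitude_one_zero (hη : η ≠ 0) (hζ : ζ ≠ 0) (hγ : γ ≠ 0)
    (hunit : η ^ 2 + ζ ^ 2 = 1) (i : ℕ) :
    HasSum (fun j => mixedAmplitude η ζ γ 1 i j * conj (mixedAmplitude η ζ γ 0 i j))
      ((poissonWeight (ζ ^ 2 * ‖γ‖ ^ 2) i * (η / ζ * (i - ζ ^ 2 * ‖γ‖ ^ 2)) : ℝ) / γ) := by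
  set π := poissonWeight (ζ ^ 2 * ‖γ‖ ^ 2) i with hπ
  have h := ((hasSum_poissonWeight (η ^ 2 * ‖γ‖ ^ 2)).mul_left (π * (η ^ 2 * i) / (η * ζ))).sub
    ((hasSum_mul_poissonWeight (η ^ 2 * ‖γ‖ ^ 2)).mul_left (π * ζ ^ 2 / (η * ζ)))
  have h' := (Complex.hasSum_ofReal.2 h).div_const γ
  have hη' : (η : ℂ) ≠ 0 := by exact_mod_cast hη
  have hζ' : (ζ : ℂ) ≠ 0 := by exact_mod_cast hζ
  have hv : π * (η / ζ * (i - ζ ^ 2 * ‖γ‖ ^ 2)) =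
      π * (η ^ 2 * i) / (η * ζ) * 1 - π * ζ ^ 2 / (η * ζ) * (η ^ 2 * ‖γ‖ ^ 2) := by
    field_simp
  rw [hv]
  refine h'.congr_fun fun j => ?_
  rw [mixedAmplitude_one hη hζ hγ, mul_right_comm, mixedAmplitude_zero_mul_conj η ζ γ hunit, ← hπ]
  push_cast
  field_simp

lemma hasSum_mixedAmplitude_one_one (hη : η ≠ 0) (hζ : ζ ≠ 0) (hγ : γ ≠ 0)
    (hunit : η ^ 2 + ζ ^ 2 = 1) (i : ℕ) :
    HasSum (fun j => mixedAmplitude η ζ γ 1 i j * conj (mixedAmplitude η ζ γ 1 i j))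
      ((poissonWeight (ζ ^ 2 * ‖γ‖ ^ 2) i *
        (η ^ 2 * (i - ζ ^ 2 * ‖γ‖ ^ 2) ^ 2 / (ζ ^ 2 * ‖γ‖ ^ 2) + ζ ^ 2) : ℝ) : ℂ) := by
  set π := poissonWeight (ζ ^ 2 * ‖γ‖ ^ 2) i with hπ
  have hR : ‖γ‖ ≠ 0 := norm_ne_zero_iff.2 hγ
  have h := (((hasSum_poissonWeight (η ^ 2 * ‖γ‖ ^ 2)).mul_left (η ^ 4 * i ^ 2)).sub
    ((hasSum_mul_poissonWeight (η ^ 2 * ‖γ‖ ^ 2)).mul_left (2 * η ^ 2 * ζ ^ 2 * i))).add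
    ((hasSum_sq_mul_poissonWeight (η ^ 2 * ‖γ‖ ^ 2)).mul_left (ζ ^ 4))
  have h' := Complex.hasSum_ofReal.2 (h.mul_left (π / (η ^ 2 * ζ ^ 2 * ‖γ‖ ^ 2)))
  convert h' using 1
  · funext j
    have hfac : (((η ^ 2 * i - ζ ^ 2 * j : ℝ) : ℂ) / (η * ζ * γ)) *
        conj (((η ^ 2 * i - ζ ^ 2 * j : ℝ) : ℂ) / (η * ζ * γ)) =
        (((η ^ 2 * i - ζ ^ 2 * j) ^ 2 / (η ^ 2 * ζ ^ 2 * ‖γ‖ ^ 2) : ℝ) : ℂ) := by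
      rw [Complex.mul_conj, Complex.normSq_eq_norm_sq, norm_div, norm_mul, norm_mul,
        Complex.norm_real, Complex.norm_real, Complex.norm_real, div_pow, mul_pow, mul_pow]
      simp only [Real.norm_eq_abs, sq_abs]
    rw [mixedAmplitude_one hη hζ hγ, map_mul, mul_mul_mul_comm, hfac,
      mixedAmplitude_zero_mul_conj η ζ γ hunit, ← hπ, ← Complex.ofReal_mul]
    congr 1
    field_simp
    ring
  · congr 1
    field_simp
    ring

end

/-! ### Reduction of the counter statistics to two pairs of modes -/

/-- The occupation numbers `a` in the first mode, `b` in the second and zero in all others. -/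
def modes {r : ℕ} (a b : ℕ) : Fock (r + 2) := Matrix.vecCons a (Matrix.vecCons b 0)

section modes
variable {r : ℕ}

@[simp] lemma modes_zero (a b : ℕ) : (modes a b : Fock (r + 2)) 0 = a := rfl

@[simp] lemma modes_one (a b : ℕ) : (modes a b : Fock (r + 2)) 1 = b := rfl

@[simp] lemma modes_succ_succ (a b : ℕ) (s : Fin r) :
    (modes a b : Fock (r + 2)) s.succ.succ = 0 := rfl

lemma modes_of_two_le (a b : ℕ) {s : Fin (r + 2)} (hs : 2 ≤ s.val) :
    (modes a b : Fock (r + 2)) s = 0 := by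
  refine Fin.cases (fun h => ?_) (fun s => Fin.cases (fun h => ?_) (fun s _ => rfl) s) s hs
  · simp at h
  · simp at h

@[simp] lemma photons_modes (a b : ℕ) : photons (modes a b : Fock (r + 2)) = a + b := by
  simp [photons, Fin.sum_univ_succ]

lemma modes_inj {a b a' b' : ℕ} :
    (modes a b : Fock (r + 2)) = modes a' b' ↔ a = a' ∧ b = b' := by
  constructor
  · intro h
    exact ⟨congrFun h 0, congrFun h 1⟩
  · rintro ⟨rfl, rfl⟩; rfl

lemma eq_modes_iff (m : Fock (r + 2)) : m = modes (m 0) (m 1) ↔ ∀ s : Fin r, m s.succ.succ = 0 := by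
  constructor
  · intro h s
    rw [h, modes_succ_succ]
  · intro h
    funext s
    exact Fin.cases rfl (fun s => Fin.cases rfl (fun s => h s) s) s

lemma coherent_single (γ : ℂ) (n : ℕ) :
    coherent (Pi.single 0 γ) (modes n 0 : Fock (r + 2)) =
      (Real.exp (-‖γ‖ ^ 2 / 2) : ℂ) * γ ^ n / (Real.sqrt n ! : ℂ) := by
  rw [coherent, Fin.prod_univ_succ]
  simp only [Pi.single_eq_same, modes_zero]
  rw [Finset.prod_eq_one, mul_one]
  intro s _
  have h0 : (modes n 0 : Fock (r + 2)) s.succ = 0 := Fin.cases rfl (fun _ => rfl) s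
  rw [h0, Pi.single_eq_of_ne (Fin.succ_ne_zero s)]
  simp

lemma coherent_single_eq_zero (γ : ℂ) {q : Fock (r + 2)} (h : q ≠ modes (q 0) 0) :
    coherent (Pi.single 0 γ) q = 0 := by
  obtain ⟨s, hs⟩ : ∃ s : Fin (r + 1), q s.succ ≠ 0 := by
    by_contra! hq
    exact h (funext fun s => Fin.cases rfl (fun s => (hq s).trans (Fin.cases rfl (fun _ => rfl) s)) s)
  refine Finset.prod_eq_zero (Finset.mem_univ s.succ) ?_
  rw [Pi.single_eq_of_ne (Fin.succ_ne_zero s), zero_pow hs]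
  simp

/-- The amplitude of the output numbers `x` for the signal input `m` and a probe with coherent
amplitude `γ` in its first mode: photon conservation in the first pair leaves a single Fock
component of the probe. -/
noncomputable def outputAmplitude (η ζ : ℝ) (γ : ℂ) (x : Fock (r + 2) × Fock (r + 2))
    (m : Fock (r + 2)) : ℂ :=
  beamSplitter η ζ x (m, modes (x.1 0 + x.2 0 - m 0) 0) *
    coherent (Pi.single 0 γ) (modes (x.1 0 + x.2 0 - m 0) 0 : Fock (r + 2))

lemma beamSplitter_mul_coherent (η ζ : ℝ) (γ : ℂ) (x : Fock (r + 2) × Fock (r + 2))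
    (m q : Fock (r + 2)) :
    beamSplitter η ζ x (m, q) * coherent (Pi.single 0 γ) q =
      if q = modes (x.1 0 + x.2 0 - m 0) 0 then outputAmplitude η ζ γ x m else 0 := by
  split_ifs with h
  · rw [outputAmplitude, ← h]
  · by_cases hq : q = modes (q 0) 0
    · have hne : x.1 0 + x.2 0 ≠ m 0 + q 0 := by
        intro he
        apply h
        rw [he, Nat.add_sub_cancel_left]
        exact hq
      rw [beamSplitter, Finset.prod_eq_zero (Finset.mem_univ 0), zero_mul]
      rw [pairAmplitude_eq_zero η ζ hne, Complex.ofReal_zero]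
    · rw [coherent_single_eq_zero γ hq, mul_zero]

lemma outputDiag_eq_sum {ρ : Matrix (Fock (r + 2)) (Fock (r + 2)) ℂ} (η ζ : ℝ) (γ : ℂ)
    (S : Finset (Fock (r + 2))) (hS : ∀ m m', ρ m m' ≠ 0 → m ∈ S ∧ m' ∈ S)
    (x : Fock (r + 2) × Fock (r + 2)) :
    outputDiag η ζ ρ (Pi.single 0 γ) x = (∑ m ∈ S, ∑ m' ∈ S,
      ρ m m' * (outputAmplitude η ζ γ x m * conj (outputAmplitude η ζ γ x m'))).re := by
  classical
  let f : Fock (r + 2) → Fock (r + 2) × Fock (r + 2) :=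
    fun m => (m, modes (x.1 0 + x.2 0 - m 0) 0)
  have hf : Function.Injective f := fun m m' h => congrArg Prod.fst h
  have hterm : ∀ y y' : Fock (r + 2) × Fock (r + 2),
      beamSplitter η ζ x y * jointInput ρ (Pi.single 0 γ) y y' * conj (beamSplitter η ζ x y') =
      ρ y.1 y'.1 * ((if y.2 = (f y.1).2 then outputAmplitude η ζ γ x y.1 else 0) *
        conj (if y'.2 = (f y'.1).2 then outputAmplitude η ζ γ x y'.1 else 0)) := by
    intro y y'
    rw [← beamSplitter_mul_coherent, ← beamSplitter_mul_coherent, jointInput, map_mul]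
    ring
  have hmem : ∀ y, y ∉ S.image f → y.1 ∈ S → y.2 ≠ (f y.1).2 := by
    intro y hy h1 h2
    exact hy (Finset.mem_image.2 ⟨y.1, h1, Prod.ext rfl h2.symm⟩)
  have hzero : ∀ y y', y ∉ S.image f ∨ y' ∉ S.image f →
      beamSplitter η ζ x y * jointInput ρ (Pi.single 0 γ) y y' * conj (beamSplitter η ζ x y') =
        0 := by
    intro y y' h
    rw [hterm]
    by_cases hρ : ρ y.1 y'.1 = 0
    · rw [hρ, zero_mul]
    · rcases h with h | h
      · rw [if_neg (hmem y h (hS _ _ hρ).1)]; simp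
      · rw [if_neg (hmem y' h (hS _ _ hρ).2)]; simp
  rw [outputDiag, tsum_eq_sum (s := S.image f), Finset.sum_image hf.injOn]
  · congr 1
    refine Finset.sum_congr rfl fun m _ => ?_
    rw [tsum_eq_sum (s := S.image f) (fun y' hy' => hzero _ _ (Or.inr hy')),
      Finset.sum_image hf.injOn]
    refine Finset.sum_congr rfl fun m' _ => ?_
    rw [hterm, if_pos rfl, if_pos rfl]
  · intro y hy
    simp only [hzero _ _ (Or.inl hy), tsum_zero]

lemma outputAmplitude_modes (η ζ : ℝ) (γ : ℂ) (a b i j k l : ℕ) :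
    outputAmplitude η ζ γ ((modes i k, modes j l) : Fock (r + 2) × Fock (r + 2)) (modes a b) =
      mixedAmplitude η ζ γ a i j * pairAmplitude η ζ k l b 0 := by
  have h1 : ∀ a b : ℕ, (modes a b : Fock (r + 2)) (Fin.succ 0) = b := fun _ _ => rfl
  rw [outputAmplitude, coherent_single, beamSplitter, Fin.prod_univ_succ, Fin.prod_univ_succ]
  simp only [modes_zero, h1, modes_succ_succ, mixedAmplitude, pairAmplitude_vacuum]
  simp
  ring

lemma outputAmplitude_eq_zero (η ζ : ℝ) (γ : ℂ) (a b : ℕ) {x : Fock (r + 2) × Fock (r + 2)}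
    {s : Fin r} (h : x.1 s.succ.succ ≠ 0 ∨ x.2 s.succ.succ ≠ 0) :
    outputAmplitude η ζ γ x (modes a b) = 0 := by
  rw [outputAmplitude, beamSplitter, Finset.prod_eq_zero (Finset.mem_univ s.succ.succ), zero_mul]
  simp only [modes_succ_succ]
  rw [pairAmplitude_vacuum, if_neg (by tauto), Complex.ofReal_zero]

/-- The weight with which the matrix element between `|a, b⟩` and `|a', b⟩` enters the probability
of `k` counts: a convolution of the statistics of the first pair of modes with the binomial
statistics of the second. -/
noncomputable def counterKernel (η ζ : ℝ) (γ : ℂ) (k a a' b : ℕ) : ℂ :=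
  ∑ p ∈ Finset.HasAntidiagonal.antidiagonal k,
    (∑' j, mixedAmplitude η ζ γ a p.1 j * conj (mixedAmplitude η ζ γ a' p.1 j)) *
      ((b.choose p.2 * (η ^ 2) ^ p.2 * (ζ ^ 2) ^ (b - p.2) : ℝ) : ℂ)

lemma hasSum_outputAmplitude (η ζ : ℝ) (γ : ℂ) (k a a' b : ℕ)
    (hs : ∀ i, Summable fun j => mixedAmplitude η ζ γ a i j * conj (mixedAmplitude η ζ γ a' i j)) :
    HasSum (fun x : {x : Fock (r + 2) × Fock (r + 2) // photons x.1 = k} =>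
        outputAmplitude η ζ γ x.1 (modes a b) * conj (outputAmplitude η ζ γ x.1 (modes a' b)))
      (counterKernel η ζ γ k a a' b) := by
  classical
  -- split the outcomes by the numbers registered in the first two modes
  have key : ∀ p ∈ Finset.HasAntidiagonal.antidiagonal k,
      HasSum (fun x : {x : Fock (r + 2) × Fock (r + 2) // photons x.1 = k} =>
        if (x.1.1 0, x.1.1 1) = p then
          outputAmplitude η ζ γ x.1 (modes a b) * conj (outputAmplitude η ζ γ x.1 (modes a' b)) else 0)
        ((∑' j, mixedAmplitude η ζ γ a p.1 j * conj (mixedAmplitude η ζ γ a' p.1 j)) *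
          ((b.choose p.2 * (η ^ 2) ^ p.2 * (ζ ^ 2) ^ (b - p.2) : ℝ) : ℂ)) := by
    rintro ⟨i, l⟩ hp
    rw [Finset.HasAntidiagonal.mem_antidiagonal] at hp
    let f : ℕ × ℕ → {x : Fock (r + 2) × Fock (r + 2) // photons x.1 = k} :=
      fun q => ⟨(modes i l, modes q.1 q.2), by simpa using hp⟩
    have hf : Function.Injective f := by
      rintro ⟨q, q'⟩ ⟨t, t'⟩ h
      have := modes_inj.1 (congrArg (fun z => z.1.2) h)
      exact Prod.ext this.1 this.2
    refine (hf.hasSum_iff ?_).1 ?_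
    · rintro ⟨x, hx⟩ hxf
      split_ifs with hxp
      · by_cases h1 : ∃ s : Fin r, x.1 s.succ.succ ≠ 0 ∨ x.2 s.succ.succ ≠ 0
        · obtain ⟨s, hs⟩ := h1
          rw [outputAmplitude_eq_zero η ζ γ a b hs, zero_mul]
        · push Not at h1
          refine absurd ⟨(x.2 0, x.2 1), ?_⟩ hxf
          refine Subtype.ext (Prod.ext ?_ ?_)
          · have := (eq_modes_iff x.1).2 fun s => (h1 s).1
            rw [Prod.mk.injEq] at hxp
            rw [hxp.1, hxp.2] at this
            exact this.symm
          · exact ((eq_modes_iff x.2).2 fun s => (h1 s).2).symm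
      · rfl
    · have h1 := (hs i).hasSum
      have h2 := hasSum_pairAmplitude_sq η ζ b l
      have h12 := summable_mul_of_summable_norm
        (f := fun j => mixedAmplitude η ζ γ a i j * conj (mixedAmplitude η ζ γ a' i j))
        (g := fun j => (pairAmplitude η ζ l j b 0 : ℂ) * conj (pairAmplitude η ζ l j b 0 : ℂ))
        h1.summable.norm h2.summable.norm
      have h3 := h1.mul h2 h12
      refine h3.congr_fun fun q => ?_
      simp only [Function.comp_apply, f, modes_zero, modes_one, if_true, outputAmplitude_modes,
        map_mul]
      ring
  refine (hasSum_sum key).congr_fun fun x => ?_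
  obtain ⟨x, hx⟩ := x
  by_cases h1 : ∃ s : Fin r, x.1 s.succ.succ ≠ 0 ∨ x.2 s.succ.succ ≠ 0
  · obtain ⟨s, hs⟩ := h1
    simp [outputAmplitude_eq_zero η ζ γ a b hs]
  · push Not at h1
    have hm := (eq_modes_iff x.1).2 fun s => (h1 s).1
    rw [Finset.sum_ite_eq, if_pos]
    rw [Finset.HasAntidiagonal.mem_antidiagonal]
    refine Eq.trans ?_ hx
    rw [hm, photons_modes]
    rfl

/-- Only matrix elements diagonal in the second mode contribute, and the counter probabilities are
their linear combinations with coefficients `counterKernel`. -/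
lemma counterProb_eq {η ζ : ℝ} {γ : ℂ} {N : ℕ} {ρ : Matrix (Fock (r + 2)) (Fock (r + 2)) ℂ}
    (hρ : ∀ m m', ρ m m' ≠ 0 →
      ∃ a < 2, ∃ a' < 2, ∃ b < N + 1, m = modes a b ∧ m' = modes a' b)
    (hs : ∀ a < 2, ∀ a' < 2, ∀ i,
      Summable fun j => mixedAmplitude η ζ γ a i j * conj (mixedAmplitude η ζ γ a' i j))
    (k : ℕ) :
    counterProb η ζ ρ (Pi.single 0 γ) k =
      (∑ b ∈ Finset.range (N + 1), ∑ a ∈ Finset.range 2, ∑ a' ∈ Finset.range 2,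
        ρ (modes a b) (modes a' b) * counterKernel η ζ γ k a a' b).re := by
  classical
  let S : Finset (Fock (r + 2)) :=
    (Finset.range (N + 1) ×ˢ Finset.range 2).image fun p => modes p.2 p.1
  have hinj : Function.Injective fun p : ℕ × ℕ => (modes p.2 p.1 : Fock (r + 2)) := by
    intro p p' h
    exact Prod.ext (modes_inj.1 h).2 (modes_inj.1 h).1
  have hS : ∀ m m', ρ m m' ≠ 0 → m ∈ S ∧ m' ∈ S := by
    intro m m' h
    obtain ⟨a, ha, a', ha', b, hb, rfl, rfl⟩ := hρ m m' h
    exact ⟨Finset.mem_image.2 ⟨(b, a), by simp; omega, rfl⟩,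
      Finset.mem_image.2 ⟨(b, a'), by simp; omega, rfl⟩⟩
  have hout : ∀ x : Fock (r + 2) × Fock (r + 2), outputDiag η ζ ρ (Pi.single 0 γ) x =
      (∑ b ∈ Finset.range (N + 1), ∑ a ∈ Finset.range 2, ∑ a' ∈ Finset.range 2,
        ρ (modes a b) (modes a' b) * (outputAmplitude η ζ γ x (modes a b) *
          conj (outputAmplitude η ζ γ x (modes a' b)))).re := by
    intro x
    rw [outputDiag_eq_sum η ζ γ S hS, Finset.sum_image hinj.injOn, Finset.sum_product]
    congr 1
    refine Finset.sum_congr rfl fun b hb => Finset.sum_congr rfl fun a _ => ?_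
    rw [Finset.sum_image hinj.injOn, Finset.sum_product]
    refine Finset.sum_eq_single b (fun b' _ hb' => Finset.sum_eq_zero fun a' _ => ?_)
      (fun h => absurd hb h)
    have : ρ (modes a b) (modes a' b') = 0 := by
      by_contra h
      obtain ⟨_, _, _, _, _, _, h1, h2⟩ := hρ _ _ h
      exact hb' ((modes_inj.1 h2).2.trans (modes_inj.1 h1).2.symm)
    simp only [this, zero_mul]
  simp only [counterProb, hout]
  refine (Complex.hasSum_re (hasSum_sum fun b _ => hasSum_sum fun a ha => hasSum_sum fun a' ha' =>
    HasSum.mul_left _ (hasSum_outputAmplitude η ζ γ k a a' b ?_))).tsum_eq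
  exact hs a (Finset.mem_range.1 ha) a' (Finset.mem_range.1 ha')

end modes

/-! ### Closed forms of the counter statistics -/

lemma mul_poissonWeight_succ {l : ℝ} (hl : l ≠ 0) (n : ℕ) :
    poissonWeight l n = poissonWeight l (n + 1) * ((n + 1 : ℝ) / l) := by
  have := succ_mul_poissonWeight_succ l n
  push_cast at this
  field_simp
  linarith

/-- Convolution of the Poisson distribution with the binomial distribution of one trial. -/
lemma sum_antidiagonal_poissonWeight_choose_one {l : ℝ} (hl : l ≠ 0) (x y : ℝ) (k : ℕ) :
    ∑ p ∈ Finset.HasAntidiagonal.antidiagonal k,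
      poissonWeight l p.1 * ((Nat.choose 1 p.2 : ℝ) * x ^ p.2 * y ^ (1 - p.2)) =
    poissonWeight l k * (y + x * k / l) := by
  rcases k with _ | k
  · simp
  · rw [Finset.Nat.sum_antidiagonal_succ', Finset.sum_eq_single (k, 0)]
    · rw [mul_poissonWeight_succ hl k]
      simp
      ring
    · rintro ⟨i, j⟩ hp hne
      rw [Finset.HasAntidiagonal.mem_antidiagonal] at hp
      have hj : j ≠ 0 := fun h => hne (by simp only [Prod.mk.injEq] at hp ⊢; omega)
      rw [Nat.choose_eq_zero_of_lt (by simp only; omega)]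
      simp
    · simp

/-- Convolution of the Poisson distribution with the binomial distribution of two trials. -/
lemma sum_antidiagonal_poissonWeight_choose_two {l : ℝ} (hl : l ≠ 0) (x y : ℝ) (k : ℕ) :
    ∑ p ∈ Finset.HasAntidiagonal.antidiagonal k,
      poissonWeight l p.1 * ((Nat.choose 2 p.2 : ℝ) * x ^ p.2 * y ^ (2 - p.2)) =
    poissonWeight l k * (y ^ 2 + 2 * x * y * k / l + x ^ 2 * (k * (k - 1)) / l ^ 2) := by
  rcases k with _ | _ | k
  · simp
  · rw [Finset.Nat.sum_antidiagonal_succ']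
    simp
    rw [mul_poissonWeight_succ hl 0]
    simp
    ring
  · rw [Finset.Nat.sum_antidiagonal_succ', Finset.Nat.sum_antidiagonal_succ',
      Finset.sum_eq_single (k, 0)]
    · simp only [zero_add]
      rw [mul_poissonWeight_succ hl k, mul_poissonWeight_succ hl (k + 1)]
      simp
      ring
    · rintro ⟨i, j⟩ hp hne
      rw [Finset.HasAntidiagonal.mem_antidiagonal] at hp
      have hj : j ≠ 0 := fun h => hne (by simp only [Prod.mk.injEq] at hp ⊢; omega)
      rw [Nat.choose_eq_zero_of_lt (by simp only; omega)]
      simp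
    · simp

section
variable {η ζ : ℝ} {γ : ℂ}

lemma hasSum_mixedAmplitude_zero_one (hη : η ≠ 0) (hζ : ζ ≠ 0) (hγ : γ ≠ 0)
    (hunit : η ^ 2 + ζ ^ 2 = 1) (i : ℕ) :
    HasSum (fun j => mixedAmplitude η ζ γ 0 i j * conj (mixedAmplitude η ζ γ 1 i j))
      (conj ((poissonWeight (ζ ^ 2 * ‖γ‖ ^ 2) i *
        (η / ζ * (i - ζ ^ 2 * ‖γ‖ ^ 2)) : ℝ) / γ)) := by
  have h := (hasSum_mixedAmplitude_one_zero hη hζ hγ hunit i).map (starRingEnd ℂ)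
    Complex.continuous_conj
  refine h.congr_fun fun j => ?_
  simp [mul_comm]

lemma summable_mixedAmplitude (hη : η ≠ 0) (hζ : ζ ≠ 0) (hγ : γ ≠ 0)
    (hunit : η ^ 2 + ζ ^ 2 = 1) :
    ∀ a < 2, ∀ a' < 2, ∀ i,
      Summable fun j => mixedAmplitude η ζ γ a i j * conj (mixedAmplitude η ζ γ a' i j) := by
  intro a ha a' ha' i
  interval_cases a <;> interval_cases a'
  · exact (hasSum_mixedAmplitude_zero_zero hunit i).summable
  · exact (hasSum_mixedAmplitude_zero_one hη hζ hγ hunit i).summable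
  · exact (hasSum_mixedAmplitude_one_zero hη hζ hγ hunit i).summable
  · exact (hasSum_mixedAmplitude_one_one hη hζ hγ hunit i).summable

/-- With the vacuum in the second pair, all counts come from the first pair. -/
lemma counterKernel_zero_right (η ζ : ℝ) (γ : ℂ) (k a a' : ℕ) :
    counterKernel η ζ γ k a a' 0 =
      ∑' j, mixedAmplitude η ζ γ a k j * conj (mixedAmplitude η ζ γ a' k j) := by
  rw [counterKernel, Finset.sum_eq_single (k, 0)]
  · simp
  · rintro ⟨i, j⟩ hp hne
    rw [Finset.HasAntidiagonal.mem_antidiagonal] at hp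
    have hj : j ≠ 0 := fun h => hne (by simp only [Prod.mk.injEq] at hp ⊢; omega)
    rw [Nat.choose_eq_zero_of_lt (by simp only; omega)]
    simp
  · simp

lemma counterKernel_zero_zero_zero (hunit : η ^ 2 + ζ ^ 2 = 1) (k : ℕ) :
    counterKernel η ζ γ k 0 0 0 = (poissonWeight (ζ ^ 2 * ‖γ‖ ^ 2) k : ℝ) := by
  rw [counterKernel_zero_right, (hasSum_mixedAmplitude_zero_zero hunit k).tsum_eq]

lemma counterKernel_one_one_zero (hη : η ≠ 0) (hζ : ζ ≠ 0) (hγ : γ ≠ 0)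
    (hunit : η ^ 2 + ζ ^ 2 = 1) (k : ℕ) :
    counterKernel η ζ γ k 1 1 0 = (poissonWeight (ζ ^ 2 * ‖γ‖ ^ 2) k *
        (η ^ 2 * (k - ζ ^ 2 * ‖γ‖ ^ 2) ^ 2 / (ζ ^ 2 * ‖γ‖ ^ 2) + ζ ^ 2) : ℝ) := by
  rw [counterKernel_zero_right, (hasSum_mixedAmplitude_one_one hη hζ hγ hunit k).tsum_eq]

lemma counterKernel_one_zero_zero (hη : η ≠ 0) (hζ : ζ ≠ 0) (hγ : γ ≠ 0)
    (hunit : η ^ 2 + ζ ^ 2 = 1) (k : ℕ) :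
    counterKernel η ζ γ k 1 0 0 = (poissonWeight (ζ ^ 2 * ‖γ‖ ^ 2) k *
        (η / ζ * (k - ζ ^ 2 * ‖γ‖ ^ 2)) : ℝ) / γ := by
  rw [counterKernel_zero_right, (hasSum_mixedAmplitude_one_zero hη hζ hγ hunit k).tsum_eq]

lemma counterKernel_zero_one_zero (hη : η ≠ 0) (hζ : ζ ≠ 0) (hγ : γ ≠ 0)
    (hunit : η ^ 2 + ζ ^ 2 = 1) (k : ℕ) :
    counterKernel η ζ γ k 0 1 0 = conj ((poissonWeight (ζ ^ 2 * ‖γ‖ ^ 2) k *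
        (η / ζ * (k - ζ ^ 2 * ‖γ‖ ^ 2)) : ℝ) / γ) := by
  rw [counterKernel_zero_right, (hasSum_mixedAmplitude_zero_one hη hζ hγ hunit k).tsum_eq]

lemma counterKernel_zero_zero_one (hζ : ζ ≠ 0) (hγ : γ ≠ 0) (hunit : η ^ 2 + ζ ^ 2 = 1) (k : ℕ) :
    counterKernel η ζ γ k 0 0 1 = (poissonWeight (ζ ^ 2 * ‖γ‖ ^ 2) k *
        (ζ ^ 2 + η ^ 2 * k / (ζ ^ 2 * ‖γ‖ ^ 2)) : ℝ) := by
  have hl : ζ ^ 2 * ‖γ‖ ^ 2 ≠ 0 := by have := norm_ne_zero_iff.2 hγ; positivity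
  rw [← sum_antidiagonal_poissonWeight_choose_one hl, counterKernel, Complex.ofReal_sum]
  refine Finset.sum_congr rfl fun p _ => ?_
  rw [(hasSum_mixedAmplitude_zero_zero hunit p.1).tsum_eq, ← Complex.ofReal_mul]

lemma counterKernel_zero_zero_two (hζ : ζ ≠ 0) (hγ : γ ≠ 0) (hunit : η ^ 2 + ζ ^ 2 = 1) (k : ℕ) :
    counterKernel η ζ γ k 0 0 2 = (poissonWeight (ζ ^ 2 * ‖γ‖ ^ 2) k *
        ((ζ ^ 2) ^ 2 + 2 * η ^ 2 * ζ ^ 2 * k / (ζ ^ 2 * ‖γ‖ ^ 2) +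
          (η ^ 2) ^ 2 * (k * (k - 1)) / (ζ ^ 2 * ‖γ‖ ^ 2) ^ 2) : ℝ) := by
  have hl : ζ ^ 2 * ‖γ‖ ^ 2 ≠ 0 := by have := norm_ne_zero_iff.2 hγ; positivity
  rw [← sum_antidiagonal_poissonWeight_choose_two hl, counterKernel, Complex.ofReal_sum]
  refine Finset.sum_congr rfl fun p _ => ?_
  rw [(hasSum_mixedAmplitude_zero_zero hunit p.1).tsum_eq, ← Complex.ofReal_mul]

/-- The linear relation between the statistics of `|1, 0⟩` and those of `|0, 0⟩`, `|0, 1⟩`, `|0, 2⟩`: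
up to the Poisson factor all four are polynomials of degree at most two in the count `k`. -/
lemma counterKernel_relation (hη : η ≠ 0) (hζ : ζ ≠ 0) (hγ : γ ≠ 0) (hunit : η ^ 2 + ζ ^ 2 = 1)
    {c : ℝ} (hc : c = ζ ^ 2 * ‖γ‖ ^ 2 / η ^ 2) (k : ℕ) :
    counterKernel η ζ γ k 1 1 0 + 2 * c * counterKernel η ζ γ k 0 0 1 =
      c * counterKernel η ζ γ k 0 0 0 + counterKernel η ζ γ k 0 0 1 +
        c * counterKernel η ζ γ k 0 0 2 := by
  rw [counterKernel_one_one_zero hη hζ hγ hunit, counterKernel_zero_zero_one hζ hγ hunit,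
    counterKernel_zero_zero_zero hunit, counterKernel_zero_zero_two hζ hγ hunit]
  have hg := norm_ne_zero_iff.2 hγ
  rw [← Complex.ofReal_ofNat]
  simp only [← Complex.ofReal_mul, ← Complex.ofReal_add]
  congr 1
  obtain rfl : c = ζ ^ 2 * ‖γ‖ ^ 2 / η ^ 2 := hc
  obtain ⟨l, hl⟩ : ∃ l, l = ζ ^ 2 * ‖γ‖ ^ 2 := ⟨_, rfl⟩
  have hl0 : l ≠ 0 := by rw [hl]; positivity
  have hz : ζ ^ 2 = 1 - η ^ 2 := by linarith
  rw [← hl, hz]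
  field_simp
  ring

end

/-! ### Twirled states with at most one photon -/

section
variable {r : ℕ}

lemma IsTwirled.exists_modes {ρ : Matrix (Fock (r + 2)) (Fock (r + 2)) ℂ} (h : IsTwirled ρ)
    {m m' : Fock (r + 2)} (hm : ρ m m' ≠ 0) :
    ∃ a a' b, m = modes a b ∧ m' = modes a' b := by
  obtain ⟨χ, hχ⟩ := h
  by_cases hc : m 1 = m' 1 ∧ ∀ s : Fin (r + 2), 2 ≤ s.val → m s = 0 ∧ m' s = 0
  · refine ⟨m 0, m' 0, m 1, (eq_modes_iff m).2 fun s => (hc.2 _ ?_).1, ?_⟩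
    · simp
    · rw [hc.1]
      exact (eq_modes_iff m').2 fun s => (hc.2 _ (by simp)).2
  · exact absurd ((hχ m m').2 hc) hm

lemma exists_modes_of_atMostPhotons {ρ : Matrix (Fock (r + 2)) (Fock (r + 2)) ℂ}
    (h : IsTwirled ρ) (h1 : AtMostPhotons ρ 1) {m m' : Fock (r + 2)} (hm : ρ m m' ≠ 0) :
    ∃ a < 2, ∃ a' < 2, ∃ b < 1 + 1, m = modes a b ∧ m' = modes a' b := by
  obtain ⟨a, a', b, rfl, rfl⟩ := h.exists_modes hm
  have := h1 _ _ hm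
  simp only [photons_modes] at this
  exact ⟨a, by omega, a', by omega, b, by omega, rfl, rfl⟩

lemma apply_modes_eq_zero {ρ : Matrix (Fock (r + 2)) (Fock (r + 2)) ℂ} {N : ℕ}
    (h1 : AtMostPhotons ρ N) {a a' b : ℕ} (h : N < a + b ∨ N < a' + b) :
    ρ (modes a b) (modes a' b) = 0 := by
  by_contra hne
  have := h1 _ _ hne
  simp only [photons_modes] at this
  omega

lemma hasSum_diagonal {ρ : Matrix (Fock (r + 2)) (Fock (r + 2)) ℂ} {N : ℕ}
    (hρ : ∀ m m', ρ m m' ≠ 0 →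
      ∃ a < 2, ∃ a' < 2, ∃ b < N + 1, m = modes a b ∧ m' = modes a' b) :
    HasSum (fun m => ρ m m)
      (∑ b ∈ Finset.range (N + 1), ∑ a ∈ Finset.range 2, ρ (modes a b) (modes a b)) := by
  classical
  have hinj : Function.Injective fun p : ℕ × ℕ => (modes p.2 p.1 : Fock (r + 2)) := by
    intro p p' h
    exact Prod.ext (modes_inj.1 h).2 (modes_inj.1 h).1
  rw [← Finset.sum_product', ← Finset.sum_image (f := fun m => ρ m m) hinj.injOn]
  refine hasSum_sum_of_ne_finset_zero fun m hm => ?_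
  by_contra hne
  obtain ⟨a, ha, _, _, b, hb, rfl, _⟩ := hρ m m hne
  exact hm (Finset.mem_image.2 ⟨(b, a), by simp; omega, rfl⟩)

lemma probe_eq_single {R : ℝ} {γ : ℂ} (hγ : ‖γ‖ = R) :
    probe r R γ.arg = (Pi.single 0 γ : Fin (r + 2) → ℂ) := by
  rw [probe, ← hγ, Complex.norm_mul_exp_arg_mul_I]

/-- The outcome probabilities of a twirled state with at most one photon, in terms of its matrix
elements. -/
lemma counterProb_of_atMostPhotons_one {η ζ : ℝ} {γ : ℂ} (hη : η ≠ 0) (hζ : ζ ≠ 0) (hγ : γ ≠ 0)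
    (hunit : η ^ 2 + ζ ^ 2 = 1) {ρ : Matrix (Fock (r + 2)) (Fock (r + 2)) ℂ} (hd : IsDensityMatrix ρ)
    (ht : IsTwirled ρ) (h1 : AtMostPhotons ρ 1) {l : ℝ} (hl : l = ζ ^ 2 * ‖γ‖ ^ 2) (k : ℕ) :
    counterProb η ζ ρ (Pi.single 0 γ) k = poissonWeight l k *
      ((ρ (modes 0 0) (modes 0 0)).re + (ρ (modes 1 0) (modes 1 0)).re *
          (η ^ 2 * (k - l) ^ 2 / l + ζ ^ 2) +
        (ρ (modes 0 1) (modes 0 1)).re * (ζ ^ 2 + η ^ 2 * k / l) +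
        2 * (η / ζ * (k - l)) * (ρ (modes 1 0) (modes 0 0) / γ).re) := by
  rw [counterProb_eq (N := 1) (fun m m' => exists_modes_of_atMostPhotons ht h1)
    (summable_mixedAmplitude hη hζ hγ hunit)]
  have hz : ∀ a a', 0 < a ∨ 0 < a' → ρ (modes a 1) (modes a' 1) = 0 := fun a a' h =>
    apply_modes_eq_zero h1 (by omega)
  have hH : ρ (modes 0 0) (modes 1 0) = conj (ρ (modes 1 0) (modes 0 0)) :=
    (hd.1.isHermitian.apply _ _).symm
  simp only [Finset.sum_range_succ, Finset.sum_range_zero, zero_add, hz 0 1 (by simp),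
    hz 1 0 (by simp), hz 1 1 (by simp), zero_mul, add_zero, hH,
    counterKernel_one_one_zero hη hζ hγ hunit, counterKernel_zero_zero_one hζ hγ hunit,
    counterKernel_zero_zero_zero hunit, counterKernel_one_zero_zero hη hζ hγ hunit,
    counterKernel_zero_one_zero hη hζ hγ hunit, ← hl, ← map_mul]
  rw [mul_div_left_comm]
  simp only [Complex.add_re, Complex.conj_re, Complex.re_ofReal_mul, Complex.re_mul_ofReal]
  ring

/-- The normalization and the probabilities of the counts `0` and `1` are three independent linear
conditions on the populations of `|0, 0⟩`, `|1, 0⟩` and `|0, 1⟩`. -/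
lemma populations_eq_zero {η ζ l x y t : ℝ} (hη : η ≠ 0) (hl : l ≠ 0) (hunit : η ^ 2 + ζ ^ 2 = 1)
    (hsum : x + y + t = 0)
    (h0 : x + y * (η ^ 2 * (0 - l) ^ 2 / l + ζ ^ 2) + t * (ζ ^ 2 + η ^ 2 * 0 / l) = 0)
    (h1 : x + y * (η ^ 2 * (1 - l) ^ 2 / l + ζ ^ 2) + t * (ζ ^ 2 + η ^ 2 * 1 / l) = 0) :
    x = 0 ∧ y = 0 ∧ t = 0 := by
  have hζ : ζ ^ 2 = 1 - η ^ 2 := by linarith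
  rw [hζ] at h0 h1
  field_simp at h0 h1
  have ht : t = y * (l - 1) := by
    have : η ^ 2 * l * (t - y * (l - 1)) = 0 := by linear_combination l * hsum - h0
    have := (mul_eq_zero.1 this).resolve_left (by positivity)
    linarith
  have hy : y = 0 := by
    have : η ^ 2 * l * y = 0 := by
      linear_combination l * hsum - h1 + η ^ 2 * (1 - l) * ht
    exact (mul_eq_zero.1 this).resolve_left (by positivity)
  have ht' : t = 0 := by rw [ht, hy, zero_mul]
  exact ⟨by linarith, hy, ht'⟩

/-- With at most one photon, the outcomes `0` and `1` for the probe amplitudes `R`, `-R` and `i R`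
already determine the state: the dependence on the phase gives the coherence, and the
probabilities of the two outcomes, with the normalization, give the three populations. -/
theorem determinedByCounter_atMostPhotons_one {η ζ R : ℝ} (hη : η ≠ 0) (hζ : ζ ≠ 0)
    (hunit : η ^ 2 + ζ ^ 2 = 1) (hR : 0 < R) :
    DeterminedByCounter r η ζ R (fun ρ => AtMostPhotons ρ 1) := by
  intro ρ σ hρ htρ hρ1 hσ htσ hσ1 hp
  have hR0 : (R : ℂ) ≠ 0 := by exact_mod_cast hR.ne'
  obtain ⟨l, hl⟩ : ∃ l, l = ζ ^ 2 * R ^ 2 := ⟨_, rfl⟩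
  have hl0 : l ≠ 0 := by rw [hl]; positivity
  set x := (ρ (modes 0 0) (modes 0 0)).re - (σ (modes 0 0) (modes 0 0)).re with hx
  set y := (ρ (modes 1 0) (modes 1 0)).re - (σ (modes 1 0) (modes 1 0)).re with hy
  set t := (ρ (modes 0 1) (modes 0 1)).re - (σ (modes 0 1) (modes 0 1)).re with ht
  set z := ρ (modes 1 0) (modes 0 0) - σ (modes 1 0) (modes 0 0) with hz
  have key : ∀ (γ : ℂ), ‖γ‖ = R → ∀ k : ℕ,
      x + y * (η ^ 2 * (k - l) ^ 2 / l + ζ ^ 2) + t * (ζ ^ 2 + η ^ 2 * k / l) +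
        2 * (η / ζ * (k - l)) * (z / γ).re = 0 := by
    intro γ hγ k
    have hγ0 : γ ≠ 0 := norm_ne_zero_iff.1 (by rw [hγ]; exact hR.ne')
    have h := hp γ.arg k
    have hlγ : l = ζ ^ 2 * ‖γ‖ ^ 2 := by rw [hl, hγ]
    rw [probe_eq_single hγ, counterProb_of_atMostPhotons_one hη hζ hγ0 hunit hρ htρ hρ1 hlγ,
      counterProb_of_atMostPhotons_one hη hζ hγ0 hunit hσ htσ hσ1 hlγ] at h
    have hpos : poissonWeight l k ≠ 0 := by rw [poissonWeight]; positivity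
    have h' := mul_left_cancel₀ hpos h
    rw [hz, sub_div, Complex.sub_re]
    linear_combination h'
  have hκ : η / ζ * l ≠ 0 := by positivity
  have e1 := key R (by simp [hR.le]) 0
  have e2 := key (-R) (by simp [hR.le]) 0
  have e3 := key (R * Complex.I) (by simp [hR.le]) 0
  have e4 := key R (by simp [hR.le]) 1
  -- the coherence term changes sign with `γ`, while the populations only see `‖γ‖`
  have hzR : (z / R).re = 0 := by
    rw [div_neg, Complex.neg_re] at e2
    refine (mul_eq_zero.1 ?_).resolve_left hκ
    push_cast at e1 e2
    linear_combination (e2 - e1) / 4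
  have hzI : (z / (R * Complex.I)).re = 0 := by
    refine (mul_eq_zero.1 ?_).resolve_left hκ
    push_cast at e1 e3
    linear_combination (e1 - e3) / 2 + (η / ζ * l) * hzR
  have hz0 : z = 0 := by
    have h1 : (z / R).im = 0 := by
      rw [← div_div, Complex.div_I] at hzI
      simpa using hzI
    have h2 : z / R = 0 := Complex.ext hzR h1
    simpa [hR0] using h2
  have htr : ∀ τ : Matrix (Fock (r + 2)) (Fock (r + 2)) ℂ, IsDensityMatrix τ → IsTwirled τ →
      AtMostPhotons τ 1 → (τ (modes 0 0) (modes 0 0)).re + (τ (modes 1 0) (modes 1 0)).re +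
        (τ (modes 0 1) (modes 0 1)).re = 1 := by
    intro τ hτ htτ hτ1
    have h := (hasSum_diagonal (N := 1) fun m m' =>
      exists_modes_of_atMostPhotons htτ hτ1).unique hτ.2
    have h' := congrArg Complex.re h
    have h11 : τ (modes 1 1) (modes 1 1) = 0 := apply_modes_eq_zero hτ1 (by simp)
    simpa [Finset.sum_range_succ, h11, add_assoc] using h'
  have hsum : x + y + t = 0 := by
    have := htr ρ hρ htρ hρ1
    have := htr σ hσ htσ hσ1
    linarith
  rw [hzR, mul_zero, add_zero] at e1 e4
  push_cast at e1 e4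
  obtain ⟨hx0, hy0, ht0⟩ := populations_eq_zero hη hl0 hunit hsum e1 e4
  have hdiag : ∀ m : Fock (r + 2), (ρ m m).re - (σ m m).re = 0 → ρ m m = σ m m := by
    intro m hm
    have him : ∀ τ : Matrix (Fock (r + 2)) (Fock (r + 2)) ℂ, IsDensityMatrix τ → (τ m m).im = 0 :=
      fun τ hτ => Complex.conj_eq_iff_im.1 (hτ.1.isHermitian.apply m m)
    exact Complex.ext (sub_eq_zero.1 hm) ((him ρ hρ).trans (him σ hσ).symm)
  have h10 : ρ (modes 1 0) (modes 0 0) = σ (modes 1 0) (modes 0 0) := sub_eq_zero.1 hz0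
  have hall : ∀ a < 2, ∀ a' < 2, ∀ b < 1 + 1,
      ρ (modes a b) (modes a' b) = σ (modes a b) (modes a' b) := by
    intro a ha a' ha' b hb
    by_cases hab : 1 < a + b ∨ 1 < a' + b
    · rw [apply_modes_eq_zero hρ1 hab, apply_modes_eq_zero hσ1 hab]
    · have hcases : (a = 0 ∧ a' = 0 ∧ b = 0) ∨ (a = 0 ∧ a' = 1 ∧ b = 0) ∨
          (a = 1 ∧ a' = 0 ∧ b = 0) ∨ (a = 1 ∧ a' = 1 ∧ b = 0) ∨ (a = 0 ∧ a' = 0 ∧ b = 1) := by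
        omega
      rcases hcases with ⟨rfl, rfl, rfl⟩ | ⟨rfl, rfl, rfl⟩ | ⟨rfl, rfl, rfl⟩ | ⟨rfl, rfl, rfl⟩ |
        ⟨rfl, rfl, rfl⟩
      · exact hdiag _ hx0
      · rw [← hρ.1.isHermitian.apply, ← hσ.1.isHermitian.apply, h10]
      · exact h10
      · exact hdiag _ hy0
      · exact hdiag _ ht0
  ext m m'
  by_cases h : ρ m m' = 0
  · by_cases h' : σ m m' = 0
    · rw [h, h']
    · obtain ⟨a, ha, a', ha', b, hb, rfl, rfl⟩ := exists_modes_of_atMostPhotons htσ hσ1 h'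
      exact hall a ha a' ha' b hb
  · obtain ⟨a, ha, a', ha', b, hb, rfl, rfl⟩ := exists_modes_of_atMostPhotons htρ hρ1 h
    exact hall a ha a' ha' b hb

end

/-! ### Indistinguishable states with at least two photons -/

/-- The mixture of the Fock states `|a, b⟩` with weights `w a b`. -/
noncomputable def fockMixture (r : ℕ) (w : ℕ → ℕ → ℝ) : Matrix (Fock (r + 2)) (Fock (r + 2)) ℂ :=
  open Classical in Matrix.diagonal fun m => if m = modes (m 0) (m 1) then (w (m 0) (m 1) : ℂ) else 0

section
variable {r : ℕ} {w : ℕ → ℕ → ℝ} {N : ℕ}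

lemma fockMixture_modes (a a' b : ℕ) :
    fockMixture r w (modes a b) (modes a' b) = if a = a' then (w a b : ℂ) else 0 := by
  classical
  rw [fockMixture, Matrix.diagonal_apply]
  simp [modes_inj]

lemma exists_modes_of_fockMixture_ne_zero {m m' : Fock (r + 2)} (h : fockMixture r w m m' ≠ 0) :
    ∃ a b, m = modes a b ∧ m' = modes a b ∧ w a b ≠ 0 := by
  classical
  rw [fockMixture, Matrix.diagonal_apply] at h
  split_ifs at h with h1 h2
  · subst h1
    exact ⟨_, _, h2, h2, by simpa using h⟩
  · exact absurd rfl h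
  · exact absurd rfl h

lemma isTwirled_fockMixture : IsTwirled (fockMixture r w) := by
  refine ⟨fun b a a' => if a = a' then (w a b : ℂ) else 0, fun m m' => ⟨?_, ?_⟩⟩
  · rintro ⟨h1, h2⟩
    have hm := (eq_modes_iff m).2 fun s => (h2 s.succ.succ (by simp)).1
    have hm' := (eq_modes_iff m').2 fun s => (h2 s.succ.succ (by simp)).2
    rw [← h1] at hm'
    conv_lhs => rw [hm, hm']
    exact fockMixture_modes _ _ _
  · intro h
    by_contra hne
    obtain ⟨a, b, rfl, rfl, _⟩ := exists_modes_of_fockMixture_ne_zero hne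
    exact h ⟨rfl, fun s hs => ⟨modes_of_two_le a b hs, modes_of_two_le a b hs⟩⟩

lemma exists_lt_of_fockMixture_ne_zero (hw : ∀ a b, w a b ≠ 0 → a < 2 ∧ a + b ≤ N)
    {m m' : Fock (r + 2)} (h : fockMixture r w m m' ≠ 0) :
    ∃ a < 2, ∃ a' < 2, ∃ b < N + 1, m = modes a b ∧ m' = modes a' b := by
  obtain ⟨a, b, h1, h2, h3⟩ := exists_modes_of_fockMixture_ne_zero h
  have := hw a b h3
  exact ⟨a, this.1, a, this.1, b, by omega, h1, h2⟩

lemma isDensityMatrix_fockMixture (hw : ∀ a b, w a b ≠ 0 → a < 2 ∧ a + b ≤ N)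
    (hpos : ∀ a b, 0 ≤ w a b)
    (hsum : ∑ b ∈ Finset.range (N + 1), (w 0 b + w 1 b) = 1) :
    IsDensityMatrix (fockMixture r w) := by
  constructor
  · refine Matrix.PosSemidef.diagonal fun m => ?_
    split_ifs
    · exact Complex.zero_le_real.2 (hpos _ _)
    · exact le_rfl
  · have h := hasSum_diagonal fun m m' => exists_lt_of_fockMixture_ne_zero (r := r) hw
    have hv : (∑ b ∈ Finset.range (N + 1), ∑ a ∈ Finset.range 2,
        fockMixture r w (modes a b) (modes a b)) = 1 := by
      simp only [fockMixture_modes, if_true, Finset.sum_range_succ _ 1, Finset.sum_range_one]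
      exact_mod_cast hsum
    rwa [hv] at h

lemma hasMaxPhotonNumber_fockMixture (hw : ∀ a b, w a b ≠ 0 → a < 2 ∧ a + b ≤ N)
    (hN : w 0 N ≠ 0) : HasMaxPhotonNumber (fockMixture r w) N := by
  constructor
  · intro m m' h
    obtain ⟨a, b, rfl, rfl, h3⟩ := exists_modes_of_fockMixture_ne_zero h
    simpa using (hw a b h3).2
  · intro n hn
    have := (hn (modes 0 N) (modes 0 N) (by simpa [fockMixture_modes] using hN)).1
    simpa using this

lemma counterProb_fockMixture {η ζ : ℝ} {γ : ℂ} (hη : η ≠ 0) (hζ : ζ ≠ 0) (hγ : γ ≠ 0)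
    (hunit : η ^ 2 + ζ ^ 2 = 1) (hw : ∀ a b, w a b ≠ 0 → a < 2 ∧ a + b ≤ N) (k : ℕ) :
    counterProb η ζ (fockMixture r w) (Pi.single 0 γ) k =
      (∑ b ∈ Finset.range (N + 1), ((w 0 b : ℂ) * counterKernel η ζ γ k 0 0 b +
        (w 1 b : ℂ) * counterKernel η ζ γ k 1 1 b)).re := by
  rw [counterProb_eq (fun m m' => exists_lt_of_fockMixture_ne_zero hw)
    (summable_mixedAmplitude hη hζ hγ hunit)]
  simp [fockMixture_modes, Finset.sum_range_succ _ 1]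

end

/-- Weights of the normalized mixture of `|1, 0⟩`, `|0, 1⟩` and `|0, N⟩` in the proportions
`1 : 2 c : 1`. -/
noncomputable def weightsWithFirstMode (c : ℝ) (N : ℕ) : ℕ → ℕ → ℝ
  | 0, b => (2 + 2 * c)⁻¹ * ((if b = 1 then 2 * c else 0) + if b = N then 1 else 0)
  | 1, b => (2 + 2 * c)⁻¹ * if b = 0 then 1 else 0
  | _, _ => 0

/-- Weights of the normalized mixture of `|0, 0⟩`, `|0, 1⟩`, `|0, 2⟩` and `|0, N⟩` in the proportions
`c : 1 : c : 1`, added up where `N` is one of the first three numbers. -/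
noncomputable def weightsWithoutFirstMode (c : ℝ) (N : ℕ) : ℕ → ℕ → ℝ
  | 0, b => (2 + 2 * c)⁻¹ * ((if b = 0 then c else 0) + (if b = 1 then 1 else 0) +
      (if b = 2 then c else 0) + if b = N then 1 else 0)
  | _, _ => 0

section
variable {c : ℝ} {N : ℕ}

lemma sum_weightsWithFirstMode (hN : 2 ≤ N) (F G : ℕ → ℂ) :
    ∑ b ∈ Finset.range (N + 1), ((weightsWithFirstMode c N 0 b : ℂ) * F b +
      (weightsWithFirstMode c N 1 b : ℂ) * G b) =
    (2 + 2 * c : ℂ)⁻¹ * (G 0 + 2 * c * F 1 + F N) := by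
  have h1 : 1 < N + 1 := by omega
  simp only [weightsWithFirstMode]
  push_cast
  simp only [mul_assoc, ← Finset.mul_sum, ← mul_add, add_mul, Finset.sum_add_distrib, ite_mul,
    zero_mul, Finset.sum_ite_eq', Finset.mem_range, h1, Nat.lt_succ_self, Nat.succ_pos, if_true,
    one_mul, apply_ite (fun t : ℝ => (t : ℂ)), Complex.ofReal_zero, Complex.ofReal_one,
    Complex.ofReal_mul, Complex.ofReal_ofNat]
  ring

lemma sum_weightsWithoutFirstMode (hN : 2 ≤ N) (F G : ℕ → ℂ) :
    ∑ b ∈ Finset.range (N + 1), ((weightsWithoutFirstMode c N 0 b : ℂ) * F b +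
      (weightsWithoutFirstMode c N 1 b : ℂ) * G b) =
    (2 + 2 * c : ℂ)⁻¹ * (c * F 0 + F 1 + c * F 2 + F N) := by
  have h1 : 1 < N + 1 := by omega
  have h2 : 2 < N + 1 := by omega
  simp only [weightsWithoutFirstMode]
  push_cast
  simp only [mul_assoc, ← Finset.mul_sum, add_mul, Finset.sum_add_distrib, ite_mul,
    zero_mul, Finset.sum_ite_eq', Finset.mem_range, h1, h2, Nat.lt_succ_self, Nat.succ_pos, if_true,
    one_mul, apply_ite (fun t : ℝ => (t : ℂ)), Complex.ofReal_zero, Complex.ofReal_one, add_zero]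

lemma weightsWithFirstMode_support (hN : 2 ≤ N) (a b : ℕ) (h : weightsWithFirstMode c N a b ≠ 0) :
    a < 2 ∧ a + b ≤ N := by
  rcases a with _ | _ | a
  · refine ⟨by omega, ?_⟩
    by_contra hb
    exact h (by simp [weightsWithFirstMode, show b ≠ 1 by omega, show b ≠ N by omega])
  · refine ⟨by omega, ?_⟩
    by_contra hb
    exact h (by simp [weightsWithFirstMode, show b ≠ 0 by omega])
  · exact absurd rfl h

lemma weightsWithoutFirstMode_support (hN : 2 ≤ N) (a b : ℕ)
    (h : weightsWithoutFirstMode c N a b ≠ 0) : a < 2 ∧ a + b ≤ N := by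
  rcases a with _ | a
  · refine ⟨by omega, ?_⟩
    by_contra hb
    exact h (by simp [weightsWithoutFirstMode, show b ≠ 0 by omega, show b ≠ 1 by omega,
      show b ≠ 2 by omega, show b ≠ N by omega])
  · exact absurd rfl h

lemma weightsWithFirstMode_nonneg (hc : 0 ≤ c) (a b : ℕ) : 0 ≤ weightsWithFirstMode c N a b := by
  rcases a with _ | _ | a <;> simp only [weightsWithFirstMode] <;> positivity

lemma weightsWithoutFirstMode_nonneg (hc : 0 ≤ c) (a b : ℕ) :
    0 ≤ weightsWithoutFirstMode c N a b := by
  rcases a with _ | a <;> simp only [weightsWithoutFirstMode] <;> positivity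

end

/-- For `2 ≤ N` two different twirled states with maximum photon number `N` have the same counter
statistics. They are the two sides of the linear relation `counterKernel_relation`, both mixed with `|0, N⟩` to reach the photon number `N`. -/
theorem exists_indistinguishable (r : ℕ) {η ζ R : ℝ} (hη : η ≠ 0) (hζ : ζ ≠ 0)
    (hunit : η ^ 2 + ζ ^ 2 = 1) (hR : 0 < R) {N : ℕ} (hN : 2 ≤ N) :
    ∃ ρ σ : Matrix (Fock (r + 2)) (Fock (r + 2)) ℂ,
      IsDensityMatrix ρ ∧ IsTwirled ρ ∧ HasMaxPhotonNumber ρ N ∧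
      IsDensityMatrix σ ∧ IsTwirled σ ∧ HasMaxPhotonNumber σ N ∧
      (∀ (θ : ℝ) (k : ℕ),
        counterProb η ζ ρ (probe r R θ) k = counterProb η ζ σ (probe r R θ) k) ∧ ρ ≠ σ := by
  obtain ⟨c, hc⟩ : ∃ c, c = ζ ^ 2 * R ^ 2 / η ^ 2 := ⟨_, rfl⟩
  have hc0 : 0 ≤ c := by rw [hc]; positivity
  have hc1 : (2 + 2 * c) ≠ 0 := by positivity
  have hc2 : (2 + 2 * c : ℂ) ≠ 0 := by exact_mod_cast hc1
  have hs1 := weightsWithFirstMode_support (c := c) hN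
  have hs2 := weightsWithoutFirstMode_support (c := c) hN
  refine ⟨fockMixture r (weightsWithFirstMode c N), fockMixture r (weightsWithoutFirstMode c N),
    isDensityMatrix_fockMixture hs1 (weightsWithFirstMode_nonneg hc0) ?_, isTwirled_fockMixture,
    hasMaxPhotonNumber_fockMixture hs1 ?_,
    isDensityMatrix_fockMixture hs2 (weightsWithoutFirstMode_nonneg hc0) ?_, isTwirled_fockMixture,
    hasMaxPhotonNumber_fockMixture hs2 ?_, ?_, ?_⟩
  · have h := sum_weightsWithFirstMode (c := c) hN (fun _ => 1) (fun _ => 1)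
    rw [show (1 + 2 * c * 1 + 1 : ℂ) = 2 + 2 * c by ring, inv_mul_cancel₀ hc2] at h
    simp only [mul_one] at h
    exact_mod_cast h
  · have h1 : N ≠ 1 := by omega
    simp [weightsWithFirstMode, h1, hc1]
  · have h := sum_weightsWithoutFirstMode (c := c) hN (fun _ => 1) (fun _ => 1)
    rw [show (c * 1 + 1 + c * 1 + 1 : ℂ) = 2 + 2 * c by ring, inv_mul_cancel₀ hc2] at h
    simp only [mul_one] at h
    exact_mod_cast h
  · have h1 : N ≠ 1 := by omega
    have h0 : N ≠ 0 := by omega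
    have : (if N = 2 then c else 0) + 1 ≠ 0 := by positivity
    simp [weightsWithoutFirstMode, h1, h0, hc1, this]
  · intro θ k
    obtain ⟨γ, hγ⟩ : ∃ γ : ℂ, γ = R * Complex.exp (θ * Complex.I) := ⟨_, rfl⟩
    have hn : ‖γ‖ = R := by rw [hγ]; simp [Complex.norm_exp_ofReal_mul_I, abs_of_pos hR]
    have hγ0 : γ ≠ 0 := norm_ne_zero_iff.1 (by rw [hn]; exact hR.ne')
    rw [probe, ← hγ, counterProb_fockMixture hη hζ hγ0 hunit hs1,
      counterProb_fockMixture hη hζ hγ0 hunit hs2, sum_weightsWithFirstMode hN,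
      sum_weightsWithoutFirstMode hN,
      counterKernel_relation hη hζ hγ0 hunit (by rw [hn]; exact hc) k]
  · intro h
    have h' := congrFun (congrFun h (modes 1 0)) (modes 1 0)
    rw [fockMixture_modes, fockMixture_modes, if_pos rfl, if_pos rfl] at h'
    simp [weightsWithFirstMode, weightsWithoutFirstMode, hc2] at h'

end WFH

theorem mainTheorem10 (r : ℕ) (η ζ R : ℝ) (hη : η ≠ 0) (hζ : ζ ≠ 0)
    (hunit : η ^ 2 + ζ ^ 2 = 1) (hR : 0 < R) (N : ℕ) :
    (WFH.DeterminedByCounter r η ζ R (fun ρ => WFH.AtMostPhotons ρ N) ↔ N ≤ 1) ∧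
    (WFH.DeterminedByCounter r η ζ R (fun ρ => WFH.HasMaxPhotonNumber ρ N) ↔ N ≤ 1) := by
  have hdet := WFH.determinedByCounter_atMostPhotons_one (r := r) hη hζ hunit hR
  have hmono : ∀ ρ : Matrix (WFH.Fock (r + 2)) (WFH.Fock (r + 2)) ℂ, N ≤ 1 →
      WFH.AtMostPhotons ρ N → WFH.AtMostPhotons ρ 1 :=
    fun ρ hN h m m' hm => ⟨(h m m' hm).1.trans hN, (h m m' hm).2.trans hN⟩
  constructor
  · constructor
    · intro h
      by_contra! hN
      obtain ⟨ρ, σ, h1, h2, h3, h4, h5, h6, h7, h8⟩ :=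
        WFH.exists_indistinguishable r hη hζ hunit hR (N := N) (by omega)
      exact h8 (h ρ σ h1 h2 h3.1 h4 h5 h6.1 h7)
    · intro hN ρ σ h1 h2 h3 h4 h5 h6
      exact hdet ρ σ h1 h2 (hmono ρ hN h3) h4 h5 (hmono σ hN h6)
  · constructor
    · intro h
      by_contra! hN
      obtain ⟨ρ, σ, h1, h2, h3, h4, h5, h6, h7, h8⟩ :=
        WFH.exists_indistinguishable r hη hζ hunit hR (N := N) (by omega)
      exact h8 (h ρ σ h1 h2 h3 h4 h5 h6 h7)
    · intro hN ρ σ h1 h2 h3 h4 h5 h6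
      exact hdet ρ σ h1 h2 (hmono ρ hN h3.1) h4 h5 (hmono σ hN h6.1)
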